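/- Conventions. An arc is a space homeomorphic to $[0,1]$. A continuum is a nonempty compact connected metric space. A graph is a continuum that is the union of finitely many arcs, any two of which are either disjoint or intersect in one or both of their end points (so the intersection consists of common end points); a tree is a graph that contains no simple closed curve. A tree-chain in $\mathbb R^2$ is a finite family of nonempty open subsets of $\mathbb R^2$ such that the geometric realization of its nerve (the simplicial complex whose simplices are the nonempty finite subfamilies with nonempty intersection) is a tree. A family $\mathcal V$ of subsets of $\mathbb R^2$ strongly refines a family $\mathcal U$ if for every $V\in\mathcal V$ there is $U\in\mathcal U$ with $\operatorname{cl}(V)\subseteq U$. Theorem 3.6. For every positive integer $n$ there exist tree-chains $\mathcal U_1,\dots,\mathcal U_n$ in $\mathbb R^2$ and functions $\varphi_k:\mathcal U_{k+1}\to\mathcal U_k$ for $k\in\{1,\dots,n-1\}$ such that: 1. for each $k\in\{1,\dots,n-1\}$, $\mathcal U_{k+1}$ strongly refines $\mathcal U_k$; 2. if $n\ge 2$, then for all $U\in\mathcal U_1$ and $V\in\mathcal U_2$: $\ U\cap V\neq\emptyset\ \Longrightarrow\ \varphi_1(V)\cap U=\emptyset$; 3. either for every $k\in\{1,\dots,n-2\}$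 and all $U\in\mathcal U_{k+2}$, $V\in\mathcal U_{k+1}$: $\ U\cap V\neq\emptyset\ \Longrightarrow\ \varphi_{k+1}(U)\cap\varphi_k(V)\neq\emptyset$; or for every $k\in\{1,\dots,n-2\}$ and all $U\in\mathcal U_{k+2}$, $V\in\mathcal U_{k+1}$: $\ \operatorname{cl}(U)\subseteq V\ \Longrightarrow\ \varphi_{k+1}(U)\subseteq\varphi_k(V)$ (the "or" is inclusive); 4. for each $k\in\{1,\dots,n-1\}$ and all $U,V\in\mathcal U_{k+1}$: $\ U\cap V\neq\emptyset\ \Longrightarrow\ \varphi_k(U)\cap\varphi_k(V)\neq\emptyset$. -/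

import Mathlib

namespace TreeChains

/-- The Euclidean plane `ℝ²`. -/
abbrev Plane : Type := EuclideanSpace ℝ (Fin 2)

section Topology

variable {X : Type*} [TopologicalSpace X] [T2Space X]

/-- A parametrized arc: a continuous injection of `[0, 1]` into a Hausdorff space, hence a
homeomorphism of `[0, 1]` onto its range. The end points of the arc are `γ 0` and `γ 1`. -/
def IsArcParam (γ : unitInterval → X) : Prop :=
  Continuous γ ∧ Function.Injective γ

/-- The subset `C` is a simple closed curve, i.e. homeomorphic to the circle. -/
def IsSimpleClosedCurve (C : Set X) : Prop :=
  ∃ γ : Circle → X, Continuous γ ∧ Function.Injective γ ∧ Set.range γ = C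

/-- The subset `G` is a (topological) graph: a continuum (nonempty, compact, connected) which is
the union of finitely many arcs, any two of which are disjoint or meet only in one or both of
their (common) end points. In a Hausdorff space a finite union of arcs is automatically
metrizable. -/
def IsGraph (G : Set X) : Prop :=
  G.Nonempty ∧ IsCompact G ∧ IsConnected G ∧
    ∃ (m : ℕ) (γ : Fin m → unitInterval → X),
      (∀ i, IsArcParam (γ i)) ∧
      (⋃ i, Set.range (γ i)) = G ∧
      ∀ i j, i ≠ j →
        Set.range (γ i) ∩ Set.range (γ j) ⊆ {γ i 0, γ i 1} ∩ {γ j 0, γ j 1}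

/-- A tree is a graph that contains no simple closed curve. -/
def IsTree (T : Set X) : Prop :=
  IsGraph T ∧ ∀ C : Set X, C ⊆ T → ¬ IsSimpleClosedCurve C

end Topology

/-- The nerve of a family `𝒰` of sets: its simplices are the nonempty finite subfamilies of `𝒰`
with a common point. -/
def nerve {X : Type*} (𝒰 : Set (Set X)) : PreAbstractSimplicialComplex (Set X) where
  faces := {s | s.Nonempty ∧ (s : Set (Set X)) ⊆ 𝒰 ∧ (⋂₀ (s : Set (Set X))).Nonempty}
  isRelLowerSet_faces := by
    rintro s ⟨hs, hsub, hne⟩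
    refine ⟨hs, fun t hts ht => ⟨ht, ?_, ?_⟩⟩
    · exact (Finset.coe_subset.mpr hts).trans hsub
    · exact hne.mono (Set.sInter_subset_sInter (Finset.coe_subset.mpr hts))

/-- The geometric realization of an abstract simplicial complex in barycentric coordinates: the
points are the `w : V → ℝ` with nonnegative coordinates of sum `1` that vanish off some simplex.
It carries the topology inherited from the product `V → ℝ`, which is the usual topology of the
realization when the complex is finite. -/
def realization {V : Type*} (K : PreAbstractSimplicialComplex V) : Set (V → ℝ) :=
  {w | ∃ s ∈ K.faces, (∀ v, 0 ≤ w v) ∧ (∀ v, v ∉ s → w v = 0) ∧ ∑ v ∈ s, w v = 1}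

/-- A tree-chain: a finite family of nonempty open sets, the geometric realization of whose nerve
is a tree. -/
def IsTreeChain {X : Type*} [TopologicalSpace X] (𝒰 : Set (Set X)) : Prop :=
  𝒰.Finite ∧ (∀ U ∈ 𝒰, IsOpen U ∧ U.Nonempty) ∧ IsTree (realization (nerve 𝒰))

/-- `𝒱` strongly refines `𝒰`: the closure of every member of `𝒱` lies in a member of `𝒰`. -/
def StronglyRefines {X : Type*} [TopologicalSpace X] (𝒱 𝒰 : Set (Set X)) : Prop :=
  ∀ V ∈ 𝒱, ∃ U ∈ 𝒰, closure V ⊆ U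

end TreeChains

/-!
The bonding maps are not required to be onto, so the chains may become shorter as they become
finer. Let `𝒰 k` be the chain of discs of radius `r k` about the points
`(0, 0), (1, 0), …, (3 (n - k) + 1, 0)`, where the radii lie strictly between `1 / 2` and `1` and
decrease with `k`. Discs of any two levels then meet exactly when their indices differ by at most
one (`disc_inter_nonempty_iff`), and the closure of a disc lies in the disc of the previous level
with the same index. Let `φ k` move the disc with index `i` to the disc of the previous level with
index `i + 3`. The lengths of the chains are chosen such that there is room for this shift. A shift
preserves differences of indices, so it preserves intersections within a level and between levels,
and a shift by three moves every disc off all discs that it meets.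

It remains to see that a chain is a tree-chain. The realization of its nerve is parametrized by an
interval through hat functions (`exists_isArcParam_realization_nerve`), so it is an arc, and an arc
contains no simple closed curve because a continuous real function on the circle takes the same
value at some pair of antipodal points (`isTree_range`).
-/

namespace TreeChains

open Set

/-! ### Arcs are trees -/

/-- The one-dimensional Borsuk–Ulam theorem, in the form that is needed here. -/
lemma not_injective_of_continuous_circle {f : Circle → ℝ} (hf : Continuous f) :
    ¬ Function.Injective f := by
  intro hinj
  have hc : Continuous fun t : ℝ => f (Circle.exp t) - f (Circle.exp (t + Real.pi)) := by
    fun_prop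
  have hper : Circle.exp (Real.pi + Real.pi) = Circle.exp 0 := by
    rw [← two_mul, Circle.exp_two_pi, Circle.exp_zero]
  obtain ⟨t, ht⟩ : ∃ t, f (Circle.exp t) - f (Circle.exp (t + Real.pi)) = 0 := by
    -- the difference changes its sign when `t` moves from `0` to `π`
    rcases le_total (f (Circle.exp 0)) (f (Circle.exp Real.pi)) with h | h
    · exact mem_range_of_exists_le_of_exists_ge hc ⟨0, by simpa using h⟩
        ⟨Real.pi, by rw [hper]; linarith⟩
    · exact mem_range_of_exists_le_of_exists_ge hc ⟨Real.pi, by rw [hper]; linarith⟩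
        ⟨0, by simpa using h⟩
  have h := hinj (sub_eq_zero.mp ht)
  rw [Circle.exp_add, left_eq_mul] at h
  have h' := congrArg Subtype.val h
  rw [Circle.coe_exp, Complex.exp_pi_mul_I, Circle.coe_one] at h'
  norm_num at h'

lemma isTree_range {X : Type*} [TopologicalSpace X] [T2Space X] {γ : unitInterval → X}
    (hγ : IsArcParam γ) : IsTree (range γ) := by
  refine ⟨⟨range_nonempty γ, isCompact_range hγ.1, isConnected_range hγ.1, 1, fun _ => γ,
    fun _ => hγ, iUnion_const _, fun i j hij => absurd (Subsingleton.elim i j) hij⟩, ?_⟩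
  rintro C hC ⟨δ, hδ, hinj, rfl⟩
  let e := (hγ.1.isClosedEmbedding hγ.2).isEmbedding.toHomeomorph
  have hmem : ∀ z, δ z ∈ range γ := fun z => hC (mem_range_self z)
  refine not_injective_of_continuous_circle (f := fun z => (e.symm ⟨δ z, hmem z⟩ : ℝ)) ?_ ?_
  · exact continuous_subtype_val.comp (e.symm.continuous.comp (hδ.subtype_mk hmem))
  · intro z w h
    exact hinj (Subtype.ext_iff.mp (e.symm.injective (Subtype.ext h)))

/-! ### The nerve of a chain -/

/-- The piecewise linear path in barycentric coordinates which is at the vertex `V i` at the time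
`i ≤ m`. -/
noncomputable def hatPath {X : Type*} (V : ℕ → Set X) (m : ℕ) (t : ℝ) : Set X → ℝ :=
  open scoped Classical in
  fun v => ∑ i ∈ Finset.range (m + 1), if v = V i then max 0 (1 - |t - i|) else 0

section Chain

variable {X : Type*} {V : ℕ → Set X} {m : ℕ}

lemma continuous_hatPath : Continuous (hatPath V m) := by
  classical
  refine continuous_pi fun v => continuous_finsetSum _ fun i _ => ?_
  split_ifs <;> fun_prop

lemma hatPath_apply (hinj : InjOn V (Iic m)) (t : ℝ) {i : ℕ} (hi : i ≤ m) :
    hatPath V m t (V i) = max 0 (1 - |t - i|) := by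
  classical
  rw [hatPath, Finset.sum_eq_single i]
  · simp
  · intro j hj hji
    exact if_neg fun h => hji (hinj (Nat.lt_succ_iff.mp (Finset.mem_range.mp hj)) hi h.symm)
  · exact fun h => absurd (Finset.mem_range.mpr (Nat.lt_succ_iff.mpr hi)) h

lemma hatPath_apply_of_notMem (t : ℝ) {v : Set X} (hv : v ∉ V '' Iic m) :
    hatPath V m t v = 0 := by
  classical
  refine Finset.sum_eq_zero fun i hi => if_neg fun h => hv ?_
  exact ⟨i, Nat.lt_succ_iff.mp (Finset.mem_range.mp hi), h.symm⟩

/-- On a unit interval between consecutive integers only two coordinates are nonzero. -/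
lemma hatPath_eq (hinj : InjOn V (Iic m)) {t : ℝ} {i : ℕ} (hi : i + 1 ≤ m) (h1 : (i : ℝ) ≤ t)
    (h2 : t ≤ i + 1) {w : Set X → ℝ} (hwi : w (V i) = i + 1 - t) (hwi' : w (V (i + 1)) = t - i)
    (hw : ∀ v, v ≠ V i → v ≠ V (i + 1) → w v = 0) : hatPath V m t = w := by
  funext v
  by_cases hv : v ∈ V '' Iic m
  · obtain ⟨j, hj, rfl⟩ := hv
    rw [hatPath_apply hinj t hj]
    rcases lt_trichotomy j i with hji | rfl | hji
    · rw [hw _ (hinj.ne hj (by simp; omega) (by omega)) (hinj.ne hj hi (by omega))]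
      have : (j : ℝ) + 1 ≤ i := by exact_mod_cast hji
      rw [abs_of_nonneg (by linarith)]
      exact max_eq_left (by linarith)
    · rw [hwi, abs_of_nonneg (by linarith), max_eq_right (by linarith)]
      ring
    · rcases Nat.eq_or_lt_of_le hji with rfl | hji'
      · push_cast
        rw [hwi', abs_of_nonpos (by linarith), max_eq_right (by linarith)]
        ring
      · rw [hw _ (hinj.ne hj (by simp; omega) (by omega)) (hinj.ne hj hi (by omega))]
        have : (i : ℝ) + 2 ≤ j := by exact_mod_cast hji'
        rw [abs_of_nonpos (by linarith)]
        exact max_eq_left (by linarith)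
  · rw [hatPath_apply_of_notMem t hv, hw]
    · rintro rfl
      exact hv ⟨i, by simp; omega, rfl⟩
    · rintro rfl
      exact hv ⟨i + 1, hi, rfl⟩

lemma exists_unit_interval {t : ℝ} (hm : 1 ≤ m) (h0 : 0 ≤ t) (h1 : t ≤ m) :
    ∃ i : ℕ, i + 1 ≤ m ∧ (i : ℝ) ≤ t ∧ t ≤ i + 1 := by
  rcases h1.lt_or_eq with h | rfl
  · exact ⟨⌊t⌋₊, (Nat.floor_lt h0).mpr h, Nat.floor_le h0, (Nat.lt_floor_add_one t).le⟩
  · refine ⟨m - 1, by omega, ?_, ?_⟩ <;> rw [Nat.cast_sub hm] <;> simp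

lemma hatPath_injOn (hinj : InjOn V (Iic m)) (hm : 1 ≤ m) :
    InjOn (hatPath V m) (Icc 0 (m : ℝ)) := by
  intro s hs t ht hst
  -- `s` lies in the unit interval from `i` to `i + 1`, so its coordinates at these two vertices are
  -- `i + 1 - s` and `s - i`; equality with the coordinates of `t` there already forces `t = s`
  obtain ⟨i, hi, h1, h2⟩ := exists_unit_interval hm hs.1 hs.2
  have ha := congrFun hst (V i)
  have hb := congrFun hst (V (i + 1))
  rw [hatPath_apply hinj _ (by omega), hatPath_apply hinj _ (by omega)] at ha
  rw [hatPath_apply hinj _ hi, hatPath_apply hinj _ hi] at hb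
  push_cast at hb
  rw [abs_of_nonneg (by linarith), max_eq_right (by linarith)] at ha
  rw [abs_of_nonpos (by linarith), max_eq_right (by linarith)] at hb
  rcases max_cases 0 (1 - |t - i|) with h | h <;>
  rcases max_cases 0 (1 - |t - (i + 1)|) with h' | h' <;>
  rcases abs_cases (t - i) with h'' | h'' <;>
  rcases abs_cases (t - (i + 1)) with h''' | h''' <;> linarith

/-- The vertices of a simplex in the nerve of a chain are among two consecutive links. -/
lemma exists_subset_pair_of_mem_nerve (hm : 1 ≤ m)
    (hV : ∀ i ≤ m, ∀ j ≤ m, (V i ∩ V j).Nonempty → j ≤ i + 1)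
    {s : Finset (Set X)} (hs : s ∈ (nerve (V '' Iic m)).faces) :
    ∃ i, i + 1 ≤ m ∧ ∀ v ∈ s, v = V i ∨ v = V (i + 1) := by
  classical
  obtain ⟨hne, hsub, x, hx⟩ := hs
  -- the least index `p` of a vertex, or `m - 1` if this is the last link
  have hex : ∃ p, p ≤ m ∧ V p ∈ s := by
    obtain ⟨v, hv⟩ := hne
    obtain ⟨p, hp, rfl⟩ := hsub hv
    exact ⟨p, hp, hv⟩
  obtain ⟨hp, hps⟩ := Nat.find_spec hex
  have hmin : ∀ q, q ≤ m → V q ∈ s → Nat.find hex ≤ q := fun q h h' => Nat.find_min' hex ⟨h, h'⟩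
  generalize Nat.find hex = p at hp hps hmin
  have key : ∀ v ∈ s, v = V p ∨ (p + 1 ≤ m ∧ v = V (p + 1)) := by
    intro v hv
    obtain ⟨q, hq, rfl⟩ := hsub hv
    have h1 := hmin q hq hv
    have h2 := hV p hp q hq ⟨x, hx _ hps, hx _ hv⟩
    rcases Nat.eq_or_lt_of_le h1 with rfl | h
    · exact Or.inl rfl
    · obtain rfl : q = p + 1 := by omega
      exact Or.inr ⟨hq, rfl⟩
  rcases Nat.eq_or_lt_of_le hp with rfl | h
  · refine ⟨p - 1, by omega, fun v hv => Or.inr ?_⟩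
    rw [Nat.sub_add_cancel hm]
    exact (key v hv).resolve_right fun h => by omega
  · exact ⟨p, h, fun v hv => (key v hv).imp_right And.right⟩

lemma image_hatPath (hm : 1 ≤ m) (hinj : InjOn V (Iic m))
    (hV : ∀ i ≤ m, ∀ j ≤ m, ((V i ∩ V j).Nonempty ↔ i ≤ j + 1 ∧ j ≤ i + 1)) :
    hatPath V m '' Icc 0 (m : ℝ) = realization (nerve (V '' Iic m)) := by
  classical
  apply Subset.antisymm
  · rintro _ ⟨t, ht, rfl⟩
    obtain ⟨i, hi, h1, h2⟩ := exists_unit_interval hm ht.1 ht.2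
    have hne : V i ≠ V (i + 1) := hinj.ne (by simp; omega) hi (by omega)
    rw [hatPath_eq hinj hi h1 h2
      (w := fun v => if v = V i then i + 1 - t else if v = V (i + 1) then t - i else 0)
      (by simp) (by simp [hne.symm]) (by intro v h h'; simp [h, h'])]
    refine ⟨{V i, V (i + 1)}, ⟨by simp, ?_, ?_⟩, ?_, ?_, ?_⟩
    · intro v hv
      rcases (by simpa using hv : v = V i ∨ v = V (i + 1)) with rfl | rfl
      · exact ⟨i, by simp; omega, rfl⟩
      · exact ⟨i + 1, hi, rfl⟩
    · simpa using (hV i (by omega) (i + 1) hi).mpr ⟨by omega, le_rfl⟩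
    · intro v
      dsimp only
      split_ifs <;> linarith
    · intro v hv
      have hv' : v ≠ V i ∧ v ≠ V (i + 1) := by simpa using hv
      simp [hv'.1, hv'.2]
    · rw [Finset.sum_pair hne]
      simp [hne.symm]
  · rintro w ⟨s, hs, hw0, hws, hsum⟩
    obtain ⟨i, hi, hpair⟩ := exists_subset_pair_of_mem_nerve hm
      (fun i hi j hj h => ((hV i hi j hj).mp h).2) hs
    have hne : V i ≠ V (i + 1) := hinj.ne (by simp; omega) hi (by omega)
    have hsum' : w (V i) + w (V (i + 1)) = 1 := by
      rw [← Finset.sum_pair hne, ← hsum]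
      refine (Finset.sum_subset (fun v hv => by simpa using hpair v hv) ?_).symm
      exact fun v _ hv => hws v hv
    have hi' : (i : ℝ) + 1 ≤ m := by exact_mod_cast hi
    have ha := hw0 (V i)
    have hb := hw0 (V (i + 1))
    refine ⟨i + w (V (i + 1)), ⟨by positivity, by linarith⟩, ?_⟩
    refine hatPath_eq hinj hi (by linarith) (by linarith) (by linarith) (by ring) ?_
    exact fun v h h' => hws v fun hv => (hpair v hv).elim h h'

lemma exists_isArcParam_realization_nerve (hm : 1 ≤ m) (hinj : InjOn V (Iic m))
    (hV : ∀ i ≤ m, ∀ j ≤ m, ((V i ∩ V j).Nonempty ↔ i ≤ j + 1 ∧ j ≤ i + 1)) :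
    ∃ γ : unitInterval → Set X → ℝ,
      IsArcParam γ ∧ range γ = realization (nerve (V '' Iic m)) := by
  have hm0 : (0 : ℝ) < m := by exact_mod_cast hm
  refine ⟨fun t => hatPath V m (m * t),
    ⟨continuous_hatPath.comp (by fun_prop), fun s t hst => ?_⟩, ?_⟩
  · have hmem : ∀ t : unitInterval, (m : ℝ) * t ∈ Icc 0 (m : ℝ) := fun t =>
      ⟨mul_nonneg hm0.le t.2.1, mul_le_of_le_one_right hm0.le t.2.2⟩
    exact Subtype.ext (mul_left_cancel₀ hm0.ne' (hatPath_injOn hinj hm (hmem s) (hmem t) hst))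
  · rw [← image_hatPath hm hinj hV]
    ext w
    constructor
    · rintro ⟨t, rfl⟩
      exact ⟨m * t, ⟨mul_nonneg hm0.le t.2.1, mul_le_of_le_one_right hm0.le t.2.2⟩, rfl⟩
    · rintro ⟨t, ht, rfl⟩
      refine ⟨⟨t / m, div_nonneg ht.1 hm0.le, div_le_one_of_le₀ ht.2 hm0.le⟩, ?_⟩
      simp only [mul_div_cancel₀ t hm0.ne']

lemma isTreeChain_image_Iic [TopologicalSpace X] (hm : 1 ≤ m) (hopen : ∀ i, IsOpen (V i))
    (hinj : InjOn V (Iic m))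
    (hV : ∀ i ≤ m, ∀ j ≤ m, ((V i ∩ V j).Nonempty ↔ i ≤ j + 1 ∧ j ≤ i + 1)) :
    IsTreeChain (V '' Iic m) := by
  refine ⟨(finite_Iic m).image V, ?_, ?_⟩
  · rintro _ ⟨i, hi, rfl⟩
    exact ⟨hopen i, by simpa using (hV i hi i hi).mpr (by omega)⟩
  · obtain ⟨γ, hγ, hrange⟩ := exists_isArcParam_realization_nerve hm hinj hV
    exact hrange ▸ isTree_range hγ

end Chain

/-! ### Chains of discs in the plane -/

/-- The radius of the discs of level `k`; it decreases with `k` and lies strictly between `1 / 2`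
and `1`. -/
noncomputable def discRadius (k : ℕ) : ℝ := 1 / 2 + 1 / (k + 3)

/-- The disc of level `k` about the point `(i, 0)`. -/
noncomputable def disc (k i : ℕ) : Set Plane :=
  Metric.ball (EuclideanSpace.single 0 (i : ℝ)) (discRadius k)

lemma half_lt_discRadius (k : ℕ) : 1 / 2 < discRadius k :=
  lt_add_of_pos_right _ (by positivity)

lemma discRadius_lt_one (k : ℕ) : discRadius k < 1 := by
  have : (1 : ℝ) / (k + 3) ≤ 1 / 3 :=
    one_div_le_one_div_of_le (by norm_num) (by linarith [(k.cast_nonneg : (0 : ℝ) ≤ k)])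
  rw [discRadius]
  linarith

lemma discRadius_succ_lt (k : ℕ) : discRadius (k + 1) < discRadius k := by
  unfold discRadius
  gcongr
  simp

lemma disc_inter_nonempty_iff (k l i j : ℕ) :
    (disc k i ∩ disc l j).Nonempty ↔ i ≤ j + 1 ∧ j ≤ i + 1 := by
  have hk := half_lt_discRadius k
  have hl := half_lt_discRadius l
  have hk' := discRadius_lt_one k
  have hl' := discRadius_lt_one l
  rw [← not_disjoint_iff_nonempty_inter, disc, disc,
    disjoint_ball_ball_iff (by linarith) (by linarith), PiLp.dist_single_same,
    Real.dist_eq, not_le]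
  constructor
  · intro h
    obtain ⟨h1, h2⟩ := abs_lt.mp h
    constructor <;> refine Nat.lt_succ_iff.mp ?_ <;> rify <;> linarith
  · rintro ⟨h1, h2⟩
    rify at h1 h2
    rw [abs_lt]
    constructor <;> linarith

lemma disc_injective (k : ℕ) : Function.Injective (disc k) := by
  intro i j h
  have hk := half_lt_discRadius k
  have hk' := discRadius_lt_one k
  -- a disc contains the centre of no other disc of its level
  have hmem : EuclideanSpace.single 0 (i : ℝ) ∈ disc k j :=
    h ▸ Metric.mem_ball_self (by linarith)
  rw [disc, Metric.mem_ball, PiLp.dist_single_same, Real.dist_eq] at hmem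
  obtain ⟨h1, h2⟩ := abs_lt.mp hmem
  refine le_antisymm ?_ ?_ <;> refine Nat.lt_succ_iff.mp ?_ <;> rify <;> linarith

lemma closure_disc_succ_subset (k i : ℕ) : closure (disc (k + 1) i) ⊆ disc k i :=
  Metric.closure_ball_subset_closedBall.trans
    (Metric.closedBall_subset_ball (discRadius_succ_lt k))

/-- The map from level `k + 1` to level `k` that moves the index of a disc by `3`; it is the
identity off the discs of level `k + 1`. -/
noncomputable def discShift (k : ℕ) (A : Set Plane) : Set Plane :=
  open scoped Classical in
  if h : ∃ i, A = disc (k + 1) i then disc k (h.choose + 3) else A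

lemma discShift_disc (k i : ℕ) : discShift k (disc (k + 1) i) = disc k (i + 3) := by
  have h : ∃ j, disc (k + 1) i = disc (k + 1) j := ⟨i, rfl⟩
  rw [discShift, dif_pos h, ← disc_injective _ h.choose_spec]

end TreeChains

open TreeChains in
/-- The families are `𝒰 1, …, 𝒰 n` and the functions are the restrictions of `φ k` to
`𝒰 (k + 1) → 𝒰 k` for `1 ≤ k ≤ n - 1`; all other values of `𝒰` and `φ` are irrelevant. -/
theorem theorem3p6 (n : ℕ) (hn : 1 ≤ n) :
    ∃ (𝒰 : ℕ → Set (Set TreeChains.Plane))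
      (φ : ℕ → Set TreeChains.Plane → Set TreeChains.Plane),
      (∀ k, 1 ≤ k → k ≤ n → TreeChains.IsTreeChain (𝒰 k)) ∧
      (∀ k, 1 ≤ k → k + 1 ≤ n → Set.MapsTo (φ k) (𝒰 (k + 1)) (𝒰 k)) ∧
      (∀ k, 1 ≤ k → k + 1 ≤ n → TreeChains.StronglyRefines (𝒰 (k + 1)) (𝒰 k)) ∧
      (2 ≤ n → ∀ U ∈ 𝒰 1, ∀ V ∈ 𝒰 2, (U ∩ V).Nonempty → φ 1 V ∩ U = ∅) ∧
      ((∀ k, 1 ≤ k → k + 2 ≤ n → ∀ U ∈ 𝒰 (k + 2), ∀ V ∈ 𝒰 (k + 1),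
          (U ∩ V).Nonempty → (φ (k + 1) U ∩ φ k V).Nonempty) ∨
        (∀ k, 1 ≤ k → k + 2 ≤ n → ∀ U ∈ 𝒰 (k + 2), ∀ V ∈ 𝒰 (k + 1),
          closure U ⊆ V → φ (k + 1) U ⊆ φ k V)) ∧
      (∀ k, 1 ≤ k → k + 1 ≤ n → ∀ U ∈ 𝒰 (k + 1), ∀ V ∈ 𝒰 (k + 1),
        (U ∩ V).Nonempty → (φ k U ∩ φ k V).Nonempty) := by
  -- a chain of two links at the last level, and three more links at each level before it, to make
  -- room for the shift
  refine ⟨fun k => disc k '' Set.Iic (3 * (n - k) + 1), discShift, ?_, ?_, ?_, ?_, Or.inl ?_, ?_⟩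
  · intro k _ _
    exact isTreeChain_image_Iic (by omega) (fun _ => Metric.isOpen_ball)
      (disc_injective k).injOn fun i _ j _ => disc_inter_nonempty_iff k k i j
  · rintro k _ hk _ ⟨i, hi, rfl⟩
    rw [discShift_disc]
    refine ⟨i + 3, ?_, rfl⟩
    rw [Set.mem_Iic] at hi ⊢
    omega
  · rintro k _ hk _ ⟨i, hi, rfl⟩
    refine ⟨disc k i, ⟨i, ?_, rfl⟩, closure_disc_succ_subset k i⟩
    rw [Set.mem_Iic] at hi ⊢
    omega
  · rintro _ _ ⟨i, _, rfl⟩ _ ⟨j, _, rfl⟩ h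
    rw [disc_inter_nonempty_iff] at h
    rw [discShift_disc, ← Set.not_nonempty_iff_eq_empty, disc_inter_nonempty_iff]
    omega
  · rintro k _ _ _ ⟨i, _, rfl⟩ _ ⟨j, _, rfl⟩ h
    rw [disc_inter_nonempty_iff] at h
    rw [discShift_disc, discShift_disc, disc_inter_nonempty_iff]
    omega
  · rintro k _ _ _ ⟨i, _, rfl⟩ _ ⟨j, _, rfl⟩ h
    rw [disc_inter_nonempty_iff] at h
    rw [discShift_disc, discShift_disc, disc_inter_nonempty_iff]
    omega
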